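/- Let $C$ be the class of continuous $2\pi$-periodic functions $f:\mathbb R\to\mathbb R$, with norm $\|f\|_C=\sup_{x\in[-\pi,\pi]}|f(x)|$. For $f\in C$ let $a_k(f)=\frac1\pi\int_{-\pi}^{\pi}f(t)\cos kt\,dt$ and $b_k(f)=\frac1\pi\int_{-\pi}^{\pi}f(t)\sin kt\,dt$ be its Fourier coefficients, $S_kf(x)=\frac{a_0(f)}2+\sum_{j=1}^{k}\bigl(a_j(f)\cos jx+b_j(f)\sin jx\bigr)$ the partial sums of its Fourier series, and for integers $0\le m\le n$ let $$\sigma_{n,m}f(x)=\frac1{m+1}\sum_{k=n-m}^{n}S_kf(x)$$ be its de la Vallée-Poussin means. Let $E_k(f)_C=\inf_T\|f-T\|_C$, the infimum being over all real trigonometric polynomials $T$ of degree at most $k$. Theorem 3 (Stečkin). There is an absolute constant $K>0$ such that, for every $f\in C$, every positive integer $n$ and every integer $m$ with $0\le m\le n$, $$\|\sigma_{n,m}f-f\|_C\le K\sum_{\nu=0}^{n}\frac{E_{n-m+\nu}(f)_C}{m+\nu+1}.$$ -/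

import Mathlib

noncomputable section

namespace VallePoussin

open Real

/-- The `C`-norm `sup_{x ∈ [-π, π]} |g x|` (used for continuous `g` only, where the supremum is
finite). -/
def normC (g : ℝ → ℝ) : ℝ :=
  sSup ((fun x => |g x|) '' Set.Icc (-π) π)

/-- Cosine Fourier coefficient `a_k(f) = (1/π) ∫_{-π}^{π} f(t) cos(kt) dt`. -/
def cosCoeff (f : ℝ → ℝ) (k : ℕ) : ℝ :=
  (1 / π) * ∫ t in (-π)..π, f t * cos ((k : ℝ) * t)

/-- Sine Fourier coefficient `b_k(f) = (1/π) ∫_{-π}^{π} f(t) sin(kt) dt`. -/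
def sinCoeff (f : ℝ → ℝ) (k : ℕ) : ℝ :=
  (1 / π) * ∫ t in (-π)..π, f t * sin ((k : ℝ) * t)

/-- Partial sum `S_k f (x) = a_0/2 + ∑_{j=1}^{k} (a_j cos(jx) + b_j sin(jx))` of the Fourier
series of `f`. -/
def partialSum (f : ℝ → ℝ) (k : ℕ) (x : ℝ) : ℝ :=
  cosCoeff f 0 / 2 + ∑ j ∈ Finset.Icc 1 k,
    (cosCoeff f j * cos ((j : ℝ) * x) + sinCoeff f j * sin ((j : ℝ) * x))

/-- De la Vallée-Poussin mean `σ_{n,m} f (x) = (1/(m+1)) ∑_{k=n-m}^{n} S_k f (x)`, for `m ≤ n`. -/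
def sigma (n m : ℕ) (f : ℝ → ℝ) (x : ℝ) : ℝ :=
  (1 / ((m : ℝ) + 1)) * ∑ k ∈ Finset.Icc (n - m) n, partialSum f k x

/-- `H_n`: the real trigonometric polynomials of degree at most `n`. -/
def trigPoly (n : ℕ) : Set (ℝ → ℝ) :=
  {T | ∃ (c : ℝ) (a b : ℕ → ℝ), ∀ x, T x = c + ∑ j ∈ Finset.Icc 1 n,
    (a j * cos ((j : ℝ) * x) + b j * sin ((j : ℝ) * x))}

/-- Best approximation `E_n(f)_C = inf_{T ∈ H_n} ‖f - T‖_C`. -/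
def bestApprox (n : ℕ) (f : ℝ → ℝ) : ℝ :=
  sInf ((fun T : ℝ → ℝ => normC (fun x => f x - T x)) '' trigPoly n)

end VallePoussin

end

noncomputable section

namespace VallePoussin

open Real

/-! Put N = n - m and q = m + 1. Averages of q and of 2q partial sums starting at N differ by half a
difference of adjacent blocks, whose kernel comes from Re(e^{i(N+1)u} (∑ e^{iau})²) and is dominated
by a Fejér kernel. So halving q costs at most the sup of |f|, with no logarithm
(`abs_deviation_le_add_double`). Doubling q up to size s, where a crude bound holds, takes about
log(s/q) steps, and the harmonic segment ∑_{i<s} 1/(q+i) pays for them. This treats polynomials of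
degree N + s, and general f when N ≤ s and q ≤ 2s.

To bring in best approximations, take near-best U_l of degree N + l. The means reproduce U_0, so f -
U_0 is what matters. Pass from f - U_i to f - U_j, with j the first index where the error has
halved; U_j - U_i is a polynomial bounded by the two errors. Between such indices the errors stay
comparable, so the costs add up to the weighted series (`le_sum_of_halving`). -/

/-! ### Two combinatorial lemmas -/

/-- The segment `∑_{i < s} 1 / (q + i)` of the harmonic series. -/
def harmonicSegment (q s : ℕ) : ℝ := ∑ i ∈ Finset.range s, 1 / ((q : ℝ) + i)

theorem div_le_harmonicSegment {q s : ℕ} (hq : 1 ≤ q) :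
    (s : ℝ) / (q + s) ≤ harmonicSegment q s := by
  have hq' : (1 : ℝ) ≤ q := by exact_mod_cast hq
  calc (s : ℝ) / (q + s) = ∑ i ∈ Finset.range s, 1 / ((q : ℝ) + s) := by
        rw [Finset.sum_const, Finset.card_range, nsmul_eq_mul, mul_one_div]
    _ ≤ _ := by
        refine Finset.sum_le_sum fun i hi => ?_
        have : (i : ℝ) ≤ s := by exact_mod_cast (Finset.mem_range.1 hi).le
        exact one_div_le_one_div_of_le (by positivity) (by linarith)

/-- After cancellation, q pairs 1/(q+i) - 1/(q+s+i) with i < q remain, each at least s/(2q(2q+s)) ≥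
1/(6q). -/
theorem harmonicSegment_two_mul_add_le {q s : ℕ} (hq : 1 ≤ q) (hs : q ≤ s) :
    harmonicSegment (2 * q) s + 1 / 6 ≤ harmonicSegment q s := by
  have hq' : (1 : ℝ) ≤ q := by exact_mod_cast hq
  have hs' : (q : ℝ) ≤ s := by exact_mod_cast hs
  have h1 := Finset.sum_range_add (fun i : ℕ => 1 / ((q : ℝ) + i)) s q
  have h2 := Finset.sum_range_add (fun i : ℕ => 1 / ((q : ℝ) + i)) q s
  have h3 : harmonicSegment (2 * q) s
      = ∑ i ∈ Finset.range s, 1 / ((q : ℝ) + ((q + i : ℕ) : ℝ)) := by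
    refine Finset.sum_congr rfl fun i _ => ?_
    push_cast
    ring
  rw [add_comm q s, h1] at h2
  have h4 : (1 : ℝ) / 6 ≤ ∑ i ∈ Finset.range q,
      (1 / ((q : ℝ) + i) - 1 / ((q : ℝ) + ((s + i : ℕ) : ℝ))) := by
    calc (1 : ℝ) / 6 = ∑ i ∈ Finset.range q, 1 / (6 * (q : ℝ)) := by
          rw [Finset.sum_const, Finset.card_range, nsmul_eq_mul]
          field_simp
      _ ≤ _ := by
          refine Finset.sum_le_sum fun i hi => ?_
          have hi' : (i : ℝ) ≤ q := by exact_mod_cast (Finset.mem_range.1 hi).le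
          have hi0 : (0 : ℝ) ≤ i := Nat.cast_nonneg i
          push_cast
          rw [div_sub_div _ _ (by positivity) (by positivity),
            div_le_div_iff₀ (by positivity) (by positivity)]
          nlinarith [mul_nonneg (sub_nonneg.2 hi') (sub_nonneg.2 hs'),
            mul_nonneg (sub_nonneg.2 hi') hi0, mul_nonneg (sub_nonneg.2 hi') (by linarith : (0:ℝ) ≤ q),
            mul_nonneg (sub_nonneg.2 hs') (by linarith : (0:ℝ) ≤ q)]
  rw [Finset.sum_sub_distrib] at h4
  rw [h3, harmonicSegment]
  linarith

/-- A quantity that grows by at most `M` when `q` is halved grows at most logarithmically. -/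
theorem le_harmonicSegment_of_doubling {r : ℕ → ℝ} {M : ℝ} (hM : 0 ≤ M) {s : ℕ}
    (hstep : ∀ q, 1 ≤ q → q < s → r q ≤ M + r (2 * q))
    (hbase : ∀ q, 1 ≤ q → s ≤ q → q ≤ 2 * s → r q ≤ 7 * M) :
    ∀ q, 1 ≤ q → q ≤ 2 * s → r q ≤ 21 * M * harmonicSegment q s := by
  intro q
  induction h : 2 * s - q using Nat.strong_induction_on generalizing q with
  | _ d ih =>
    intro hq hqs
    by_cases hc : s ≤ q
    · refine (hbase q hq hc hqs).trans ?_
      have hq' : (1 : ℝ) ≤ q := by exact_mod_cast hq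
      have hqs' : (q : ℝ) ≤ 2 * s := by exact_mod_cast hqs
      -- This fixes the constant 21 = 7 · 3; the doubling step only needs 21/6 ≥ 1.
      have h1 : (1 : ℝ) / 3 ≤ s / (q + s) := by
        rw [div_le_div_iff₀ (by norm_num) (by linarith)]
        linarith
      nlinarith [div_le_harmonicSegment (s := s) hq]
    · push Not at hc
      have h1 := ih (2 * s - 2 * q) (by omega) (2 * q) rfl (by omega) (by omega)
      have h2 := harmonicSegment_two_mul_add_le hq hc.le
      nlinarith [hstep q hq hc]

/-- Summation along a sequence of indices at which `e` halves. -/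
theorem le_sum_of_halving {e w r : ℕ → ℝ} (he0 : ∀ i, 0 ≤ e i)
    (hw : ∀ i, 0 ≤ w i) {C : ℝ} (hC : 0 ≤ C) {n : ℕ}
    (hlast : ∀ i ≤ n, r i ≤ C * (∑ l ∈ Finset.range (n + 1), w l) * e i)
    (hstep : ∀ i j, i < j → j ≤ n →
      r i ≤ C * (∑ l ∈ Finset.range j, w l) * (e i + e j) + r j) :
    ∀ i ≤ n, r i ≤ C * (4 * (∑ l ∈ Finset.range i, w l) * e i
      + 8 * ∑ l ∈ Finset.Ico i (n + 1), w l * e l) := by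
  have tail : ∀ i j, i ≤ j → (∀ l, i ≤ l → l < j → e i ≤ 2 * e l) →
      (∑ l ∈ Finset.Ico i j, w l) * e i ≤ 2 * ∑ l ∈ Finset.Ico i j, w l * e l := by
    intro i j _ hl
    rw [Finset.sum_mul, Finset.mul_sum]
    refine Finset.sum_le_sum fun l hm => ?_
    rw [Finset.mem_Ico] at hm
    nlinarith [mul_le_mul_of_nonneg_left (hl l hm.1 hm.2) (hw l)]
  intro i
  induction h : n - i using Nat.strong_induction_on generalizing i with
  | _ d ih =>
    intro hi
    by_cases hex : ∃ j, i < j ∧ j ≤ n ∧ e j ≤ e i / 2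
    · obtain ⟨hj1, hj2, hj3⟩ := Nat.find_spec hex
      have hmin : ∀ l, i ≤ l → l < Nat.find hex → e i ≤ 2 * e l := by
        intro l hl1 hl2
        rcases hl1.eq_or_lt with rfl | hl1
        · linarith [he0 i]
        · by_contra hcon
          exact Nat.find_min hex hl2 ⟨hl1, by omega, by linarith⟩
      generalize Nat.find hex = j at hj1 hj2 hj3 hmin
      have h1 := ih (n - j) (by omega) j rfl hj2
      have h2 := hstep i j hj1 hj2
      have h3 := tail i j hj1.le hmin
      have h4 := Finset.sum_range_add_sum_Ico w hj1.le
      have h5 := Finset.sum_Ico_consecutive (fun l => w l * e l) hj1.le (by omega : j ≤ n + 1)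
      have h6 : 0 ≤ ∑ l ∈ Finset.range j, w l := Finset.sum_nonneg fun l _ => hw l
      refine h2.trans ((add_le_add le_rfl h1).trans ?_)
      rw [mul_assoc, ← mul_add]
      refine mul_le_mul_of_nonneg_left ?_ hC
      rw [← h5]
      -- With W_j the sum of w below j, the terms W_j(e_i + e_j) + 4 W_j e_j are at most 3.5 W_j
      -- e_i. The available 4 W_j e_i splits at i, and `tail` turns its second part into the factor
      -- 8.
      have h7 : (∑ l ∈ Finset.range j, w l) * e j ≤ (∑ l ∈ Finset.range j, w l) * (e i / 2) :=
        mul_le_mul_of_nonneg_left hj3 h6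
      have h8 : (∑ l ∈ Finset.range j, w l) * e i
          = (∑ l ∈ Finset.range i, w l) * e i + (∑ l ∈ Finset.Ico i j, w l) * e i := by
        rw [← h4, add_mul]
      have h9 : 0 ≤ (∑ l ∈ Finset.range j, w l) * e i := mul_nonneg h6 (he0 i)
      linarith
    · push Not at hex
      have h3 := tail i (n + 1) (by omega) fun l hl1 hl2 => by
        rcases hl1.eq_or_lt with rfl | hl1
        · linarith [he0 i]
        · linarith [hex l hl1 (by omega)]
      have h4 := Finset.sum_range_add_sum_Ico w (by omega : i ≤ n + 1)
      refine (hlast i hi).trans ?_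
      rw [mul_assoc]
      refine mul_le_mul_of_nonneg_left ?_ hC
      rw [← h4, add_mul]
      have h6 : 0 ≤ (∑ l ∈ Finset.range i, w l) * e i :=
        mul_nonneg (Finset.sum_nonneg fun l _ => hw l) (he0 i)
      have h7 : 0 ≤ ∑ l ∈ Finset.Ico i (n + 1), w l * e l :=
        Finset.sum_nonneg fun l _ => mul_nonneg (hw l) (he0 l)
      linarith

/-! ### Harmonics and partial sums -/

/-- The `k`-th harmonic `a_k(f) cos(kx) + b_k(f) sin(kx)`. -/
def harmonic (f : ℝ → ℝ) (k : ℕ) (x : ℝ) : ℝ :=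
  cosCoeff f k * cos ((k : ℝ) * x) + sinCoeff f k * sin ((k : ℝ) * x)

theorem harmonic_eq_integral {f : ℝ → ℝ} (hf : Continuous f) (k : ℕ) (x : ℝ) :
    harmonic f k x = (1 / π) * ∫ t in (-π)..π, f t * cos ((k : ℝ) * (x - t)) := by
  have h : (fun t => f t * cos ((k : ℝ) * (x - t))) = fun t =>
      cos ((k : ℝ) * x) * (f t * cos ((k : ℝ) * t))
        + sin ((k : ℝ) * x) * (f t * sin ((k : ℝ) * t)) := by
    funext t
    rw [mul_sub, cos_sub]
    ring
  rw [h, intervalIntegral.integral_add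
    (Continuous.intervalIntegrable (by fun_prop) _ _)
    (Continuous.intervalIntegrable (by fun_prop) _ _),
    intervalIntegral.integral_const_mul, intervalIntegral.integral_const_mul, harmonic, cosCoeff,
    sinCoeff]
  ring

theorem partialSum_zero (f : ℝ → ℝ) (x : ℝ) : partialSum f 0 x = harmonic f 0 x / 2 := by
  simp [partialSum, harmonic]

theorem partialSum_succ (f : ℝ → ℝ) (k : ℕ) (x : ℝ) :
    partialSum f (k + 1) x = partialSum f k x + harmonic f (k + 1) x := by
  rw [partialSum, partialSum, Finset.sum_Icc_succ_top (by omega), ← add_assoc]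
  rfl

theorem partialSum_add_sub (f : ℝ → ℝ) (k s : ℕ) (x : ℝ) :
    partialSum f (k + s) x - partialSum f k x
      = ∑ b ∈ Finset.range s, harmonic f (k + b + 1) x := by
  induction s with
  | zero => simp
  | succ s ih =>
    rw [Finset.sum_range_succ, ← ih, ← add_assoc, partialSum_succ]
    ring

theorem harmonic_add {f g : ℝ → ℝ} (hf : Continuous f) (hg : Continuous g) (k : ℕ) (x : ℝ) :
    harmonic (fun y => f y + g y) k x = harmonic f k x + harmonic g k x := by
  rw [harmonic_eq_integral (f := fun y => f y + g y) (by fun_prop), harmonic_eq_integral hf, harmonic_eq_integral hg,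
    ← mul_add, ← intervalIntegral.integral_add (Continuous.intervalIntegrable (by fun_prop) _ _)
    (Continuous.intervalIntegrable (by fun_prop) _ _)]
  simp only [add_mul]

theorem harmonic_const_mul (c : ℝ) (f : ℝ → ℝ) (k : ℕ) (x : ℝ) :
    harmonic (fun y => c * f y) k x = c * harmonic f k x := by
  simp only [harmonic, cosCoeff, sinCoeff, mul_assoc, intervalIntegral.integral_const_mul]
  ring

theorem partialSum_add {f g : ℝ → ℝ} (hf : Continuous f) (hg : Continuous g) (k : ℕ) (x : ℝ) :
    partialSum (fun y => f y + g y) k x = partialSum f k x + partialSum g k x := by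
  induction k with
  | zero => rw [partialSum_zero, partialSum_zero, partialSum_zero, harmonic_add hf hg]; ring
  | succ k ih => rw [partialSum_succ, partialSum_succ, partialSum_succ, harmonic_add hf hg, ih]; ring

theorem partialSum_const_mul (c : ℝ) (f : ℝ → ℝ) (k : ℕ) (x : ℝ) :
    partialSum (fun y => c * f y) k x = c * partialSum f k x := by
  induction k with
  | zero => rw [partialSum_zero, partialSum_zero, harmonic_const_mul]; ring
  | succ k ih => rw [partialSum_succ, partialSum_succ, harmonic_const_mul, ih]; ring

/-! ### Reproduction of trigonometric polynomials -/

theorem integral_cos_add_int_mul (α : ℝ) (k : ℤ) :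
    ∫ t in (-π)..π, cos (α + k * t) = if k = 0 then 2 * π * cos α else 0 := by
  split_ifs with h
  · subst h
    simp only [Int.cast_zero, zero_mul, add_zero, intervalIntegral.integral_const, smul_eq_mul]
    ring
  · have hk : (k : ℝ) ≠ 0 := by exact_mod_cast h
    rw [intervalIntegral.integral_comp_add_mul cos hk, integral_cos, smul_eq_mul]
    have h1 : α + k * π = α + k * -π + k * (2 * π) := by ring
    rw [h1, sin_add_int_mul_two_pi, sub_self, mul_zero]

/-- The phase α covers cosines and sines at once. The case i = j = 0 is excluded because the zeroth
harmonic doubles constants. -/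
theorem harmonic_cos_add (α : ℝ) (j i : ℕ) (hij : 0 < i + j) (x : ℝ) :
    harmonic (fun t => cos (α + j * t)) i x = if i = j then cos (α + j * x) else 0 := by
  have h : (fun t => cos (α + j * t) * cos ((i : ℝ) * (x - t))) = fun t =>
      2⁻¹ * (cos ((α + i * x) + ((j - i : ℤ) : ℝ) * t)
        + cos ((α - i * x) + ((j + i : ℤ) : ℝ) * t)) := by
    funext t
    have h1 : (α + i * x) + ((j - i : ℤ) : ℝ) * t = (α + j * t) + i * (x - t) := by
      push_cast; ring
    have h2 : (α - i * x) + ((j + i : ℤ) : ℝ) * t = (α + j * t) - i * (x - t) := by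
      push_cast; ring
    rw [h1, h2, cos_add (α + j * t), cos_sub (α + j * t)]
    ring
  rw [harmonic_eq_integral (by fun_prop), h, intervalIntegral.integral_const_mul,
    intervalIntegral.integral_add (Continuous.intervalIntegrable (by fun_prop) _ _)
    (Continuous.intervalIntegrable (by fun_prop) _ _), integral_cos_add_int_mul,
    integral_cos_add_int_mul, if_neg (by omega : ¬ ((j : ℤ) + i = 0))]
  by_cases hji : i = j
  · subst hji
    simp only [sub_self, if_true]
    field_simp
    ring
  · rw [if_neg (by omega), if_neg hji]
    simp

theorem partialSum_one (k : ℕ) (x : ℝ) : partialSum (fun _ => 1) k x = 1 := by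
  induction k with
  | zero =>
    rw [partialSum_zero, harmonic_eq_integral continuous_const]
    simp
    field_simp
    ring
  | succ k ih =>
    have := harmonic_cos_add 0 0 (k + 1) (by omega) x
    simp only [Nat.cast_zero, zero_mul, add_zero, cos_zero] at this
    rw [partialSum_succ, ih, this]
    simp

theorem partialSum_cos_add (α : ℝ) {j : ℕ} (hj : 1 ≤ j) (k : ℕ) (x : ℝ) :
    partialSum (fun t => cos (α + j * t)) k x = if j ≤ k then cos (α + j * x) else 0 := by
  induction k with
  | zero =>
    rw [partialSum_zero, harmonic_cos_add _ _ _ (by omega), if_neg (by omega), if_neg (by omega)]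
    simp
  | succ k ih =>
    rw [partialSum_succ, ih, harmonic_cos_add _ _ _ (by omega)]
    split_ifs <;> first | omega | simp

theorem continuous_of_mem_trigPoly {d : ℕ} {T : ℝ → ℝ} (hT : T ∈ trigPoly d) : Continuous T := by
  obtain ⟨c, a, b, h⟩ := hT
  rw [funext h]
  fun_prop

theorem trigPoly_mono : Monotone trigPoly := by
  rintro d d' hd T ⟨c, a, b, h⟩
  refine ⟨c, fun j => if j ≤ d then a j else 0, fun j => if j ≤ d then b j else 0, fun x => ?_⟩
  rw [h x]
  congr 1
  rw [← Finset.sum_subset (Finset.Icc_subset_Icc_right hd)]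
  · refine Finset.sum_congr rfl fun j hj => ?_
    rw [Finset.mem_Icc] at hj
    simp [hj.2]
  · intro j hj hj'
    rw [Finset.mem_Icc] at hj hj'
    have : ¬ j ≤ d := by omega
    simp [this]

theorem sub_mem_trigPoly {d : ℕ} {S T : ℝ → ℝ} (hS : S ∈ trigPoly d) (hT : T ∈ trigPoly d) :
    (fun x => S x - T x) ∈ trigPoly d := by
  obtain ⟨c, a, b, h⟩ := hS
  obtain ⟨c', a', b', h'⟩ := hT
  refine ⟨c - c', fun j => a j - a' j, fun j => b j - b' j, fun x => ?_⟩
  simp only [h, h', add_sub_add_comm, ← Finset.sum_sub_distrib]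
  congr 1
  exact Finset.sum_congr rfl fun j _ => by ring

theorem partialSum_of_mem_trigPoly {d : ℕ} {T : ℝ → ℝ} (hT : T ∈ trigPoly d) {k : ℕ}
    (hk : d ≤ k) (x : ℝ) : partialSum T k x = T x := by
  obtain ⟨c, a, b, h⟩ := hT
  rw [funext h]
  clear h T
  induction d with
  | zero =>
    have := partialSum_const_mul c (fun _ => 1) k x
    simp only [mul_one, partialSum_one] at this
    simpa using this
  | succ d ih =>
    have h1 : (fun y : ℝ => c + ∑ j ∈ Finset.Icc 1 (d + 1),
        (a j * cos ((j : ℝ) * y) + b j * sin ((j : ℝ) * y))) = fun y =>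
        (c + ∑ j ∈ Finset.Icc 1 d, (a j * cos ((j : ℝ) * y) + b j * sin ((j : ℝ) * y)))
        + (a (d + 1) * cos (0 + ((d + 1 : ℕ) : ℝ) * y)
          + b (d + 1) * cos (-(π / 2) + ((d + 1 : ℕ) : ℝ) * y)) := by
      funext y
      rw [Finset.sum_Icc_succ_top (by omega), zero_add, neg_add_eq_sub, cos_sub_pi_div_two]
      ring
    rw [h1, partialSum_add (by fun_prop) (by fun_prop), ih (by omega),
      partialSum_add (f := fun y => a (d + 1) * cos (0 + ((d + 1 : ℕ) : ℝ) * y)) (by fun_prop)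
        (by fun_prop),
      partialSum_const_mul, partialSum_const_mul, partialSum_cos_add _ (by omega),
      partialSum_cos_add _ (by omega), if_pos hk, if_pos hk]

/-! ### Kernel estimates -/

/-- `|∑_{a < s} e^{iau}|²`, that is `2s` times the Fejér kernel. -/
def fejerSq (s : ℕ) (u : ℝ) : ℝ :=
  (∑ a ∈ Finset.range s, cos (a * u)) ^ 2 + (∑ a ∈ Finset.range s, sin (a * u)) ^ 2

theorem fejerSq_nonneg (s : ℕ) (u : ℝ) : 0 ≤ fejerSq s u := by
  unfold fejerSq
  positivity

theorem continuous_fejerSq (s : ℕ) : Continuous (fejerSq s) := by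
  unfold fejerSq
  fun_prop

/-- Expand |D + e^{isu}|² for D = ∑_{a<s} e^{iau}; the increment is twice the Dirichlet kernel. -/
theorem fejerSq_succ (s : ℕ) (u : ℝ) :
    fejerSq (s + 1) u = fejerSq s u + (1 + 2 * ∑ j ∈ Finset.range s, cos (((j + 1 : ℕ) : ℝ) * u)) := by
  have h : ∑ j ∈ Finset.range s, cos (((j + 1 : ℕ) : ℝ) * u)
      = (∑ a ∈ Finset.range s, cos (a * u)) * cos (s * u)
        + (∑ a ∈ Finset.range s, sin (a * u)) * sin (s * u) := by
    rw [← Finset.sum_range_reflect, Finset.sum_mul, Finset.sum_mul, ← Finset.sum_add_distrib]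
    refine Finset.sum_congr rfl fun a ha => ?_
    rw [Finset.mem_range] at ha
    have : ((s - 1 - a + 1 : ℕ) : ℝ) = s - a := by
      rw [show s - 1 - a + 1 = s - a by omega, Nat.cast_sub ha.le]
    rw [this, sub_mul, cos_sub]
    ring
  rw [h, fejerSq, fejerSq, Finset.sum_range_succ, Finset.sum_range_succ]
  linear_combination cos_sq_add_sin_sq (s * u)

theorem integral_fejerSq (s : ℕ) (x : ℝ) :
    ∫ t in (-π)..π, fejerSq s (x - t) = 2 * π * s := by
  induction s with
  | zero => simp [fejerSq]
  | succ s ih =>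
    have h0 : Continuous fun t => fejerSq s (x - t) := (continuous_fejerSq s).comp (by fun_prop)
    simp only [fejerSq_succ]
    rw [intervalIntegral.integral_add (h0.intervalIntegrable _ _)
      (Continuous.intervalIntegrable (by fun_prop) _ _), ih, intervalIntegral.integral_add
      (Continuous.intervalIntegrable (by fun_prop) _ _)
      (Continuous.intervalIntegrable (by fun_prop) _ _), intervalIntegral.integral_const_mul,
      intervalIntegral.integral_finsetSum
        (fun j _ => Continuous.intervalIntegrable (by fun_prop) _ _)]
    have : ∀ j ∈ Finset.range s, ∫ t in (-π)..π, cos (((j + 1 : ℕ) : ℝ) * (x - t)) = 0 := by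
      intro j _
      have h := integral_cos_add_int_mul (((j + 1 : ℕ) : ℝ) * x) (-((j + 1 : ℕ) : ℤ))
      rw [if_neg (by omega)] at h
      rw [← h]
      congr 1
      funext t
      congr 1
      push_cast
      ring
    rw [Finset.sum_eq_zero this]
    simp
    ring

/-- A convolution whose kernel is dominated by `fejerSq s` is bounded by `2 s` times the bound
of the function. -/
theorem abs_integral_mul_le_of_le_fejerSq {f : ℝ → ℝ} {M : ℝ}
    (hM : ∀ t ∈ Set.Icc (-π) π, |f t| ≤ M) {s : ℕ} {G : ℝ → ℝ}
    (hG : ∀ u, |G u| ≤ fejerSq s u) (x : ℝ) :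
    |(1 / π) * ∫ t in (-π)..π, f t * G (x - t)| ≤ 2 * s * M := by
  have hπ := pi_pos
  have h0 : Continuous fun t => fejerSq s (x - t) := (continuous_fejerSq s).comp (by fun_prop)
  have h1 : |∫ t in (-π)..π, f t * G (x - t)| ≤ ∫ t in (-π)..π, M * fejerSq s (x - t) := by
    rw [← Real.norm_eq_abs]
    refine intervalIntegral.norm_integral_le_of_norm_le (by linarith)
      (Filter.Eventually.of_forall fun t ht => ?_)
      (Continuous.intervalIntegrable (by fun_prop) _ _)
    rw [Real.norm_eq_abs, abs_mul]
    have := hM t ⟨ht.1.le, ht.2⟩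
    exact mul_le_mul this (hG _) (abs_nonneg _) ((abs_nonneg _).trans this)
  rw [intervalIntegral.integral_const_mul, integral_fejerSq] at h1
  rw [abs_mul, abs_of_pos (by positivity), one_div, inv_mul_le_iff₀ hπ]
  linarith

/-- The double sum is the real part of e^{i(N+1)u} (X + iY)², of modulus X² + Y². -/
theorem abs_sum_sum_cos_le (N s : ℕ) (u : ℝ) :
    |∑ a ∈ Finset.range s, ∑ b ∈ Finset.range s, cos (((N + a + b + 1 : ℕ) : ℝ) * u)|
      ≤ fejerSq s u := by
  set X := ∑ a ∈ Finset.range s, cos (a * u) with hX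
  set Y := ∑ a ∈ Finset.range s, sin (a * u) with hY
  have h : ∑ a ∈ Finset.range s, ∑ b ∈ Finset.range s, cos (((N + a + b + 1 : ℕ) : ℝ) * u)
      = cos ((N + 1) * u) * (X * X - Y * Y) - sin ((N + 1) * u) * (X * Y + Y * X) := by
    simp only [hX, hY, Finset.sum_mul_sum]
    simp only [← Finset.sum_sub_distrib, ← Finset.sum_add_distrib, Finset.mul_sum]
    refine Finset.sum_congr rfl fun a _ => Finset.sum_congr rfl fun b _ => ?_
    have : ((N + a + b + 1 : ℕ) : ℝ) * u = (N + 1) * u + (a * u + b * u) := by push_cast; ring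
    rw [this, cos_add, cos_add (a * u), sin_add (a * u)]
    ring
  have h2 := cos_sq_add_sin_sq ((N + 1) * u)
  rw [h, fejerSq]
  refine abs_le_of_sq_le_sq ?_ (by positivity)
  generalize cos ((N + 1) * u) = c at *
  generalize sin ((N + 1) * u) = d at *
  have h3 : (X ^ 2 + Y ^ 2) ^ 2 = (c * (X * X - Y * Y) - d * (X * Y + Y * X)) ^ 2
      + (d * (X * X - Y * Y) + c * (X * Y + Y * X)) ^ 2 := by
    linear_combination -(X ^ 2 + Y ^ 2) ^ 2 * h2
  rw [h3]
  linarith [sq_nonneg (d * (X * X - Y * Y) + c * (X * Y + Y * X))]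

theorem abs_sum_partialSum_sub_le {f : ℝ → ℝ} (hf : Continuous f) {M : ℝ}
    (hM : ∀ t ∈ Set.Icc (-π) π, |f t| ≤ M) (N s : ℕ) (x : ℝ) :
    |∑ a ∈ Finset.range s, (partialSum f (N + a + s) x - partialSum f (N + a) x)|
      ≤ 2 * s * M := by
  refine le_of_eq_of_le ?_ (abs_integral_mul_le_of_le_fejerSq hM (abs_sum_sum_cos_le N s) x)
  congr 1
  simp only [partialSum_add_sub, harmonic_eq_integral hf, Finset.mul_sum]
  rw [intervalIntegral.integral_finsetSum
    (fun j _ => Continuous.intervalIntegrable (by fun_prop) _ _), Finset.mul_sum]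
  refine Finset.sum_congr rfl fun a _ => ?_
  rw [intervalIntegral.integral_finsetSum
    (fun j _ => Continuous.intervalIntegrable (by fun_prop) _ _), Finset.mul_sum]

theorem sum_partialSum_eq_integral {f : ℝ → ℝ} (hf : Continuous f) (s : ℕ) (x : ℝ) :
    ∑ k ∈ Finset.range s, partialSum f k x
      = (1 / π) * ∫ t in (-π)..π, f t * (2⁻¹ * fejerSq s (x - t)) := by
  have hF := continuous_fejerSq
  have hpartial : ∀ k, partialSum f k x = (1 / π) * ∫ t in (-π)..π,
      f t * (2⁻¹ * (1 + 2 * ∑ j ∈ Finset.range k, cos (((j + 1 : ℕ) : ℝ) * (x - t)))) := by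
    intro k
    induction k with
    | zero =>
      simp only [partialSum_zero, harmonic_eq_integral hf, Finset.range_zero, Finset.sum_empty,
        Nat.cast_zero, zero_mul, cos_zero, mul_zero, add_zero, mul_one,
        intervalIntegral.integral_mul_const]
      ring
    | succ k ih =>
      rw [partialSum_succ, ih, harmonic_eq_integral hf, ← mul_add, ← intervalIntegral.integral_add
        (Continuous.intervalIntegrable (by fun_prop) _ _)
        (Continuous.intervalIntegrable (by fun_prop) _ _)]
      congr 2
      funext t
      rw [Finset.sum_range_succ]
      ring
  induction s with
  | zero => simp [fejerSq]
  | succ s ih =>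
    have h0 : Continuous fun t => fejerSq s (x - t) := (continuous_fejerSq s).comp (by fun_prop)
    rw [Finset.sum_range_succ, ih, hpartial, ← mul_add, ← intervalIntegral.integral_add
        (Continuous.intervalIntegrable (by fun_prop) _ _)
        (Continuous.intervalIntegrable (by fun_prop) _ _)]
    congr 2
    funext t
    rw [fejerSq_succ]
    ring

theorem abs_sum_partialSum_le {f : ℝ → ℝ} (hf : Continuous f) {M : ℝ}
    (hM : ∀ t ∈ Set.Icc (-π) π, |f t| ≤ M) (s : ℕ) (x : ℝ) :
    |∑ k ∈ Finset.range s, partialSum f k x| ≤ 2 * s * M := by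
  rw [sum_partialSum_eq_integral hf]
  refine abs_integral_mul_le_of_le_fejerSq hM (G := fun u => 2⁻¹ * fejerSq s u) (fun u => ?_) x
  rw [abs_of_nonneg (mul_nonneg (by norm_num) (fejerSq_nonneg s u))]
  linarith [fejerSq_nonneg s u]

/-! ### The deviation of the de la Vallée-Poussin means -/

/-- The deviation `σ_{N+q-1,q-1} f - f`. -/
def deviation (N q : ℕ) (f : ℝ → ℝ) (x : ℝ) : ℝ :=
  (1 / (q : ℝ)) * ∑ k ∈ Finset.range q, partialSum f (N + k) x - f x

theorem sigma_sub_eq_deviation {n m : ℕ} (hm : m ≤ n) (f : ℝ → ℝ) (x : ℝ) :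
    sigma n m f x - f x = deviation (n - m) (m + 1) f x := by
  rw [sigma, deviation, ← Finset.Ico_succ_right_eq_Icc, Finset.sum_Ico_eq_sum_range]
  have : Order.succ n - (n - m) = m + 1 := by
    rw [Nat.succ_eq_succ]
    omega
  rw [this]
  push_cast
  rfl

theorem deviation_add {f g : ℝ → ℝ} (hf : Continuous f) (hg : Continuous g) (N q : ℕ) (x : ℝ) :
    deviation N q (fun y => f y + g y) x = deviation N q f x + deviation N q g x := by
  simp only [deviation, partialSum_add hf hg, Finset.sum_add_distrib]
  ring

theorem abs_deviation_le_add_double {f : ℝ → ℝ} (hf : Continuous f) {M : ℝ}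
    (hM : ∀ t ∈ Set.Icc (-π) π, |f t| ≤ M) (N : ℕ) {q : ℕ} (hq : 1 ≤ q) (x : ℝ) :
    |deviation N q f x| ≤ M + |deviation N (2 * q) f x| := by
  have hq' : (0 : ℝ) < q := by exact_mod_cast hq
  have h1 := abs_sum_partialSum_sub_le hf hM N q x
  have h2 : deviation N q f x = deviation N (2 * q) f x - (1 / (2 * (q : ℝ)))
      * ∑ a ∈ Finset.range q, (partialSum f (N + a + q) x - partialSum f (N + a) x) := by
    have h3 : ∑ a ∈ Finset.range q, partialSum f (N + (q + a)) x
        = ∑ a ∈ Finset.range q, partialSum f (N + a + q) x :=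
      Finset.sum_congr rfl fun a _ => by rw [add_comm q a, add_assoc]
    rw [deviation, deviation, two_mul q, Finset.sum_range_add, Finset.sum_sub_distrib, h3]
    push_cast
    field_simp
    ring
  have h4 : |(1 / (2 * (q : ℝ))) * ∑ a ∈ Finset.range q,
      (partialSum f (N + a + q) x - partialSum f (N + a) x)| ≤ M := by
    rw [abs_mul, abs_of_pos (by positivity), one_div, inv_mul_le_iff₀ (by positivity)]
    exact h1
  rw [h2]
  linarith [abs_sub (deviation N (2 * q) f x) ((1 / (2 * (q : ℝ)))
      * ∑ a ∈ Finset.range q, (partialSum f (N + a + q) x - partialSum f (N + a) x))]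

/-- Partial sums of order at least N + s reproduce T. Only the first s terms contribute, and T can
be written there as the partial sum shifted by s. -/
theorem abs_deviation_le_of_degree_le {N s q : ℕ} {T : ℝ → ℝ} (hT : T ∈ trigPoly (N + s)) {M : ℝ}
    (hM : ∀ t ∈ Set.Icc (-π) π, |T t| ≤ M) (hq : 1 ≤ q) (hs : s ≤ q) (x : ℝ) :
    |deviation N q T x| ≤ 2 * s / q * M := by
  have hq' : (0 : ℝ) < q := by exact_mod_cast hq
  have h1 := abs_sum_partialSum_sub_le (continuous_of_mem_trigPoly hT) hM N s x
  obtain ⟨d, rfl⟩ := Nat.exists_eq_add_of_le hs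
  have h2 : deviation N (s + d) T x = -((1 / ((s + d : ℕ) : ℝ))
      * ∑ a ∈ Finset.range s, (partialSum T (N + a + s) x - partialSum T (N + a) x)) := by
    have h3 : ∑ a ∈ Finset.range s, partialSum T (N + a + s) x = s * T x := by
      rw [Finset.sum_congr rfl fun a _ =>
        partialSum_of_mem_trigPoly hT (by omega : N + s ≤ N + a + s) x]
      simp
    have h4 : ∑ a ∈ Finset.range d, partialSum T (N + (s + a)) x = d * T x := by
      rw [Finset.sum_congr rfl fun a _ =>
        partialSum_of_mem_trigPoly hT (by omega : N + s ≤ N + (s + a)) x]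
      simp
    rw [deviation, Finset.sum_range_add, Finset.sum_sub_distrib, h3, h4]
    field_simp
    push_cast
    ring
  rw [h2, abs_neg, abs_mul, abs_of_pos (by positivity), one_div, inv_mul_le_iff₀ (by positivity)]
  refine h1.trans (le_of_eq ?_)
  field_simp

theorem abs_deviation_le_of_le {f : ℝ → ℝ} (hf : Continuous f) {M : ℝ}
    (hM : ∀ t ∈ Set.Icc (-π) π, |f t| ≤ M) {N q : ℕ} (hq : 1 ≤ q) (hN : N ≤ q) {x : ℝ}
    (hx : x ∈ Set.Icc (-π) π) :
    |deviation N q f x| ≤ 7 * M := by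
  have hq' : (0 : ℝ) < q := by exact_mod_cast hq
  have hN' : (N : ℝ) ≤ q := by exact_mod_cast hN
  have h1 := abs_sum_partialSum_le hf hM (N + q) x
  have h2 := abs_sum_partialSum_le hf hM N x
  have hM0 : 0 ≤ M := (abs_nonneg _).trans (hM x hx)
  rw [Finset.sum_range_add] at h1
  -- The block is a difference of two initial sums, so its bound is 2(N+q)M + 2NM ≤ 6qM; f itself
  -- adds the seventh M.
  have h3 : |(1 / (q : ℝ)) * ∑ k ∈ Finset.range q, partialSum f (N + k) x| ≤ 6 * M := by
    rw [abs_mul, abs_of_pos (by positivity), one_div, inv_mul_le_iff₀ (by positivity)]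
    push_cast at h1
    rw [abs_le] at h1 h2 ⊢
    constructor <;> nlinarith
  rw [deviation]
  linarith [abs_sub ((1 / (q : ℝ)) * ∑ k ∈ Finset.range q, partialSum f (N + k) x) (f x), hM x hx]

/-- For q ≤ 2s, double until q ≥ s, where the reproduction bound gives 2M. For larger q that bound
already has the size of the segment. -/
theorem abs_deviation_le_of_mem_trigPoly {N s q : ℕ} {T : ℝ → ℝ} (hT : T ∈ trigPoly (N + s))
    {M : ℝ} (hM : ∀ t ∈ Set.Icc (-π) π, |T t| ≤ M) (hq : 1 ≤ q) {x : ℝ}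
    (hx : x ∈ Set.Icc (-π) π) :
    |deviation N q T x| ≤ 21 * M * harmonicSegment q s := by
  have hM0 : 0 ≤ M := (abs_nonneg _).trans (hM x hx)
  have hT' := continuous_of_mem_trigPoly hT
  by_cases hqs : q ≤ 2 * s
  · refine le_harmonicSegment_of_doubling (r := fun q => |deviation N q T x|) hM0
      (fun q hq _ => abs_deviation_le_add_double hT' hM N hq x) (fun q hq hs _ => ?_) q hq hqs
    refine (abs_deviation_le_of_degree_le hT hM hq hs x).trans
      (mul_le_mul_of_nonneg_right ?_ hM0)
    have hq' : (0 : ℝ) < q := by exact_mod_cast hq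
    have hs' : (s : ℝ) ≤ q := by exact_mod_cast hs
    rw [div_le_iff₀ hq']
    linarith
  · push Not at hqs
    have hq' : (0 : ℝ) < q := by exact_mod_cast hq
    have hs' : (s : ℝ) ≤ q := by exact_mod_cast (by omega : s ≤ q)
    have hs0 : (0 : ℝ) ≤ s := Nat.cast_nonneg s
    have h1 : 2 * (s : ℝ) / q ≤ 21 * (s / (q + s)) := by
      rw [← mul_div_assoc, div_le_div_iff₀ hq' (by linarith)]
      nlinarith [mul_nonneg hs0 (sub_nonneg.2 hs'), mul_nonneg hs0 hs0]
    have h2 := div_le_harmonicSegment (s := s) hq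
    calc |deviation N q T x| ≤ 2 * s / q * M :=
          abs_deviation_le_of_degree_le hT hM hq (by omega) x
      _ ≤ (21 * harmonicSegment q s) * M := mul_le_mul_of_nonneg_right (by linarith) hM0
      _ = _ := by ring

theorem abs_deviation_le {f : ℝ → ℝ} (hf : Continuous f) {M : ℝ}
    (hM : ∀ t ∈ Set.Icc (-π) π, |f t| ≤ M) {N q s : ℕ} (hq : 1 ≤ q) (hN : N ≤ s)
    (hqs : q ≤ 2 * s) {x : ℝ} (hx : x ∈ Set.Icc (-π) π) :
    |deviation N q f x| ≤ 21 * M * harmonicSegment q s :=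
  le_harmonicSegment_of_doubling (r := fun q => |deviation N q f x|)
    ((abs_nonneg _).trans (hM x hx))
    (fun _ hq _ => abs_deviation_le_add_double hf hM N hq x)
    (fun _ hq hs _ => abs_deviation_le_of_le hf hM hq (hN.trans hs) hx) q hq hqs

/-! ### Best approximation -/

theorem abs_le_normC {g : ℝ → ℝ} (hg : Continuous g) {x : ℝ} (hx : x ∈ Set.Icc (-π) π) :
    |g x| ≤ normC g :=
  le_csSup (isCompact_Icc.image hg.abs).bddAbove ⟨x, hx, rfl⟩

theorem normC_le {g : ℝ → ℝ} {M : ℝ} (h : ∀ x ∈ Set.Icc (-π) π, |g x| ≤ M) : normC g ≤ M := by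
  refine csSup_le ⟨_, 0, ⟨by linarith [pi_pos], pi_pos.le⟩, rfl⟩ ?_
  rintro _ ⟨x, hx, rfl⟩
  exact h x hx

theorem normC_nonneg (g : ℝ → ℝ) : 0 ≤ normC g := by
  refine Real.sSup_nonneg ?_
  rintro _ ⟨x, _, rfl⟩
  exact abs_nonneg _

theorem trigPoly_nonempty (d : ℕ) : (trigPoly d).Nonempty :=
  ⟨fun _ => 0, 0, 0, 0, fun x => by simp⟩

theorem bestApprox_nonneg (d : ℕ) (f : ℝ → ℝ) : 0 ≤ bestApprox d f := by
  refine Real.sInf_nonneg ?_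
  rintro _ ⟨T, _, rfl⟩
  exact normC_nonneg _

theorem exists_mem_trigPoly_abs_sub_le {f : ℝ → ℝ} (hf : Continuous f) (d : ℕ) {ε : ℝ}
    (hε : 0 < ε) :
    ∃ T ∈ trigPoly d, ∀ x ∈ Set.Icc (-π) π, |f x - T x| ≤ bestApprox d f + ε := by
  obtain ⟨_, ⟨T, hT, rfl⟩, h⟩ := exists_lt_of_csInf_lt ((trigPoly_nonempty d).image
    fun T : ℝ → ℝ => normC fun x => f x - T x) (lt_add_of_pos_right (bestApprox d f) hε)
  exact ⟨T, hT, fun x hx =>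
    (abs_le_normC (hf.sub (continuous_of_mem_trigPoly hT)) hx).trans h.le⟩

theorem abs_deviation_le_sum_bestApprox {f : ℝ → ℝ} (hf : Continuous f) {n N q : ℕ} (hq : 1 ≤ q)
    (hn : N + q = n + 1) {ε : ℝ} (hε : 0 < ε) {x : ℝ} (hx : x ∈ Set.Icc (-π) π) :
    |deviation N q f x| ≤
      168 * ∑ l ∈ Finset.range (n + 1), 1 / ((q : ℝ) + l) * (bestApprox (N + l) f + ε) := by
  choose U hU hUf using fun l => exists_mem_trigPoly_abs_sub_le hf (N + l) hε
  have hUc : ∀ l, Continuous (U l) := fun l => continuous_of_mem_trigPoly (hU l)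
  have hsum : ∀ l, deviation N q f x
      = deviation N q (fun y => f y - U l y) x + deviation N q (U l) x := by
    intro l
    rw [← deviation_add (f := fun y => f y - U l y) (hf.sub (hUc l)) (hUc l)]
    simp only [sub_add_cancel]
  have hzero : deviation N q (U 0) x = 0 := by
    have := abs_deviation_le_of_degree_le (hU 0) (fun t ht => abs_le_normC (hUc 0) ht) hq
      (Nat.zero_le q) x
    simpa using this
  -- Starting at index 0 the prefix term vanishes, leaving 168 = 21 · 8.
  have key := le_sum_of_halving (e := fun l => bestApprox (N + l) f + ε)
    (w := fun l : ℕ => 1 / ((q : ℝ) + l)) (r := fun l => |deviation N q (fun y => f y - U l y) x|)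
    (fun i => add_nonneg (bestApprox_nonneg _ _) hε.le) (fun i => by positivity)
    (by norm_num : (0 : ℝ) ≤ 21) (n := n) ?_ ?_ 0 (Nat.zero_le n)
  · rw [hsum 0, hzero, add_zero]
    refine key.trans (le_of_eq ?_)
    rw [Finset.range_zero, Finset.sum_empty, Finset.range_eq_Ico]
    ring
  · intro i _
    refine (abs_deviation_le (hf.sub (hUc i)) (hUf i) hq (by omega : N ≤ n + 1) (by omega)
      hx).trans (le_of_eq ?_)
    rw [harmonicSegment]
    ring
  · intro i j hij _
    have h1 : deviation N q (fun y => f y - U i y) x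
        = deviation N q (fun y => U j y - U i y) x + deviation N q (fun y => f y - U j y) x := by
      rw [← deviation_add (f := fun y => U j y - U i y) (g := fun y => f y - U j y)
        ((hUc j).sub (hUc i)) (hf.sub (hUc j))]
      congr 1
      funext y
      ring
    have h2 := abs_deviation_le_of_mem_trigPoly
      (sub_mem_trigPoly (hU j) (trigPoly_mono (by omega : N + i ≤ N + j) (hU i)))
      (M := bestApprox (N + i) f + ε + (bestApprox (N + j) f + ε)) (fun t ht => ?_) hq hx
    · rw [h1]
      refine (abs_add_le _ _).trans (add_le_add (h2.trans (le_of_eq ?_)) le_rfl)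
      rw [harmonicSegment]
      ring
    · have h3 : U j t - U i t = (f t - U i t) - (f t - U j t) := by ring
      rw [h3]
      exact (abs_sub _ _).trans (add_le_add (hUf i t ht) (hUf j t ht))

end VallePoussin

end

theorem theorem3 :
    ∃ K : ℝ, 0 < K ∧
      ∀ f : ℝ → ℝ, Continuous f → Function.Periodic f (2 * Real.pi) →
        ∀ n m : ℕ, 0 < n → m ≤ n →
          VallePoussin.normC (fun x => VallePoussin.sigma n m f x - f x) ≤
            K * ∑ ν ∈ Finset.range (n + 1),
              VallePoussin.bestApprox (n - m + ν) f / ((m : ℝ) + (ν : ℝ) + 1) := by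
  refine ⟨168, by norm_num, fun f hf _ n m _ hm => ?_⟩
  set w : ℝ := ∑ ν ∈ Finset.range (n + 1), 1 / ((m : ℝ) + (ν : ℝ) + 1) with hw
  have hw0 : 0 ≤ w := Finset.sum_nonneg fun ν _ => by positivity
  refine le_of_forall_pos_le_add fun δ hδ => VallePoussin.normC_le fun x hx => ?_
  rw [VallePoussin.sigma_sub_eq_deviation hm]
  -- Near-best approximants cost ε at every index, in total 168 w ε ≤ δ.
  have hε : 0 < δ / (168 * (w + 1)) := by positivity
  refine (VallePoussin.abs_deviation_le_sum_bestApprox hf (n := n) (by omega) (by omega) hε hx).trans ?_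
  have h : ∑ l ∈ Finset.range (n + 1), 1 / (((m + 1 : ℕ) : ℝ) + l)
      * (VallePoussin.bestApprox (n - m + l) f + δ / (168 * (w + 1)))
      = ∑ ν ∈ Finset.range (n + 1),
          VallePoussin.bestApprox (n - m + ν) f / ((m : ℝ) + (ν : ℝ) + 1)
        + w * (δ / (168 * (w + 1))) := by
    rw [hw, Finset.sum_mul, ← Finset.sum_add_distrib]
    refine Finset.sum_congr rfl fun l _ => ?_
    push_cast
    rw [add_right_comm (m : ℝ) 1 l]
    ring
  rw [h, mul_add]
  have h2 : 168 * (w * (δ / (168 * (w + 1)))) ≤ δ := by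
    rw [show 168 * (w * (δ / (168 * (w + 1)))) = δ * (w / (w + 1)) by field_simp]
    exact mul_le_of_le_one_right hδ.le ((div_le_one (by positivity)).2 (by linarith))
  linarith
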